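/- Let $\mathbb{F}$ be a field of characteristic $0$, and let $\mathcal{T}$ be the free symmetric operad over $\mathbb{F}$ generated by one binary operation $(a_1,a_2)\mapsto a_1a_2$ without symmetries; its component $\mathcal{T}(n)$ has as a basis the multilinear nonassociative monomials in $a_1,\dots,a_n$, on which $S_n$ acts by permuting the arguments. For $\mathbf{x}=(x_1,\dots,x_6)\in\mathbb{F}^6$, let $\mathcal{O}_{\mathbf{x}}=\mathcal{T}/\mathcal{J}_{\mathbf{x}}$, where $\mathcal{J}_{\mathbf{x}}$ is the operad ideal (a family of $S_n$-submodules of the $\mathcal{T}(n)$, closed under composition on both sides with elements of $\mathcal{T}$) generated by the relation $$(a_1a_2)a_3 = x_1\,a_1(a_2a_3)+x_2\,a_1(a_3a_2)+x_3\,a_2(a_1a_3)+x_4\,a_2(a_3a_1)+x_5\,a_3(a_1a_2)+x_6\,a_3(a_2a_1). \qquad \text{(LR)}$$ Call $\mathbf{x}$ regular if for every $n\ge 1$ the $S_n$-module $\mathcal{O}_{\mathbf{x}}(n)$ is isomorphic to the regular module $\mathbb{F}S_n$. Suppose that $x_5=x_6=0$. Then $\mathbf{x}$ is regular if and only if $(x_1,x_2,x_3,x_4)$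 is one of $$(0,0,0,0),\qquad (1,0,0,0),\qquad (1,1,0,0),\qquad (1,0,-1,0).$$ For these four points, (LR) is respectively the left-nilpotent identity $(a_1a_2)a_3=0$, associativity $(a_1a_2)a_3=a_1(a_2a_3)$, the (right) Zinbiel identity $(a_1a_2)a_3=a_1(a_2a_3)+a_1(a_3a_2)$, and the (left) Leibniz identity $(a_1a_2)a_3=a_1(a_2a_3)-a_2(a_1a_3)$. -/

import Mathlib

noncomputable section

namespace LROperad

/-! ### Multilinear nonassociative monomials -/

/-- The multiset of letters (with multiplicity) occurring in a nonassociative word. -/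
def letters {α : Type*} : FreeMagma α → Multiset α
  | .of a => {a}
  | .mul u v => letters u + letters v

/-- A bracketed word in `a₁, …, aₙ` (letters indexed by `Fin n`) in which every letter occurs
exactly once. -/
def IsMultilinear {n : ℕ} (w : FreeMagma (Fin n)) : Prop :=
  letters w = Finset.univ.val

/-- Multilinear nonassociative monomials of arity `n`: all bracketings of all orderings of
`a₁, …, aₙ`. -/
abbrev Monomial (n : ℕ) : Type := {w : FreeMagma (Fin n) // IsMultilinear w}

theorem letters_lift {α β : Type*} (f : α → FreeMagma β) (w : FreeMagma α) :
    letters (FreeMagma.lift f w) = (letters w).bind fun a => letters (f a) := by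
  induction w with
  | ih1 a => simp [letters]
  | ih2 u v hu hv =>
    rw [map_mul]
    change letters (FreeMagma.lift f u) + letters (FreeMagma.lift f v) =
      (letters u + letters v).bind _
    rw [hu, hv, Multiset.add_bind]

theorem letters_map {α β : Type*} (f : α → β) (w : FreeMagma α) :
    letters (FreeMagma.map f w) = (letters w).map f := by
  rw [FreeMagma.map, letters_lift]
  exact Multiset.bind_singleton _ f

/-- Renaming the letters of a multilinear monomial by a permutation: `aᵢ ↦ a_{σ(i)}`. -/
def Monomial.relabel {n : ℕ} (σ : Equiv.Perm (Fin n)) (w : Monomial n) : Monomial n :=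
  ⟨FreeMagma.map σ w.1, by
    have h : letters w.1 = Finset.univ.val := w.2
    rw [IsMultilinear, letters_map, h, ← Equiv.coe_toEmbedding, ← Finset.map_val,
      Finset.map_univ_equiv]⟩

theorem Monomial.relabel_one {n : ℕ} (w : Monomial n) : w.relabel 1 = w :=
  Subtype.ext <| by
    change FreeMagma.map id w.1 = w.1
    induction w.1 with
    | ih1 a => rfl
    | ih2 u v hu hv => rw [map_mul, hu, hv]

theorem Monomial.relabel_mul {n : ℕ} (σ τ : Equiv.Perm (Fin n)) (w : Monomial n) :
    w.relabel (σ * τ) = (w.relabel τ).relabel σ :=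
  Subtype.ext <| by
    change FreeMagma.map (σ * τ) w.1 = FreeMagma.map σ (FreeMagma.map τ w.1)
    induction w.1 with
    | ih1 a => rfl
    | ih2 u v hu hv => simp only [map_mul, hu, hv]

/-- The word substituted for the letter `aⱼ` of the outer monomial when a monomial `v` of arity `m`
is inserted in place of the letter `aᵢ`: letters before `aᵢ` keep their index, letters after it are
shifted by `m - 1`, and `aᵢ` itself is replaced by `v(aᵢ, …, a_{i+m-1})`. -/
def substLetter {n m : ℕ} (i : Fin (n + 1)) (v : FreeMagma (Fin m)) (j : Fin (n + 1)) :
    FreeMagma (Fin (n + m)) :=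
  if hlt : j < i then .of ⟨j, by omega⟩
  else if hgt : i < j then .of ⟨j - 1 + m, by omega⟩
  else FreeMagma.map (fun k : Fin m => (⟨i + k, by omega⟩ : Fin (n + m))) v

theorem isMultilinear_iff {n : ℕ} (w : FreeMagma (Fin n)) :
    IsMultilinear w ↔ (letters w).Nodup ∧ ∀ k, k ∈ letters w := by
  constructor
  · intro h
    rw [IsMultilinear] at h
    rw [h]
    exact ⟨Finset.univ.nodup, fun k => Finset.mem_univ k⟩
  · rintro ⟨h₁, h₂⟩
    exact (Multiset.Nodup.ext h₁ Finset.univ.nodup).2 fun k =>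
      ⟨fun _ => Finset.mem_univ k, fun _ => h₂ k⟩

theorem mem_letters_substLetter {n m : ℕ} (i : Fin (n + 1)) (v : Monomial m) (j : Fin (n + 1))
    (k : Fin (n + m)) :
    k ∈ letters (substLetter i v.1 j) ↔
      ((j < i ∧ k.1 = j.1) ∨ (i < j ∧ k.1 = j.1 - 1 + m) ∨
        (j = i ∧ i.1 ≤ k.1 ∧ k.1 < i.1 + m)) := by
  have hv := ((isMultilinear_iff v.1).1 v.2).2
  unfold substLetter
  split_ifs with h₁ h₂
  · simp only [letters, Multiset.mem_singleton, Fin.ext_iff, Fin.lt_def] at *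
    omega
  · simp only [letters, Multiset.mem_singleton, Fin.ext_iff, Fin.lt_def] at *
    omega
  · rw [letters_map, Multiset.mem_map]
    constructor
    · rintro ⟨a, -, rfl⟩
      simp only [Fin.ext_iff, Fin.lt_def] at *
      omega
    · intro h
      refine ⟨⟨k.1 - i.1, ?_⟩, hv _, ?_⟩ <;> simp only [Fin.ext_iff, Fin.lt_def] at * <;> omega

theorem isMultilinear_subst {n m : ℕ} (i : Fin (n + 1)) (w : Monomial (n + 1)) (v : Monomial m) :
    IsMultilinear (FreeMagma.lift (substLetter i v.1) w.1) := by
  have hw : letters w.1 = Finset.univ.val := w.2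
  rw [isMultilinear_iff, letters_lift, hw]
  constructor
  · rw [Multiset.nodup_bind]
    constructor
    · intro j _
      unfold substLetter
      split_ifs
      · exact Multiset.nodup_singleton _
      · exact Multiset.nodup_singleton _
      · rw [letters_map]
        refine Multiset.Nodup.map ?_ ((isMultilinear_iff v.1).1 v.2).1
        intro a b hab
        simp only [Fin.ext_iff] at *
        omega
    · refine Multiset.Nodup.pairwise (fun a _ b _ hab => ?_) Finset.univ.nodup
      refine Multiset.disjoint_left.2 fun {k} ha hb => ?_
      rw [mem_letters_substLetter] at ha hb
      simp only [Fin.ext_iff, Fin.lt_def, ne_eq] at *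
      omega
  · intro k
    rw [Multiset.mem_bind]
    rcases lt_or_ge k.1 i.1 with h | h
    · exact ⟨⟨k.1, by omega⟩, Finset.mem_univ_val _, (mem_letters_substLetter ..).2 <| .inl
        ⟨h, rfl⟩⟩
    rcases lt_or_ge k.1 (i.1 + m) with h' | h'
    · exact ⟨i, Finset.mem_univ_val _, (mem_letters_substLetter ..).2 <| .inr <| .inr ⟨rfl, h, h'⟩⟩
    · refine ⟨⟨k.1 - m + 1, by omega⟩, Finset.mem_univ_val _, (mem_letters_substLetter ..).2 <|
        .inr <| .inl ⟨?_, ?_⟩⟩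
      · simp only [Fin.lt_def]; omega
      · simp only; omega

/-- Partial composition `w ∘ᵢ v` of monomials: substitute `v(aᵢ, …, a_{i+m-1})` for the `i`-th
argument of `w`. The arity of the result is `(n + 1) + m - 1 = n + m`. -/
def Monomial.comp {n m : ℕ} (i : Fin (n + 1)) (w : Monomial (n + 1)) (v : Monomial m) :
    Monomial (n + m) :=
  ⟨FreeMagma.lift (substLetter i v.1) w.1, isMultilinear_subst i w v⟩

/-! ### The free symmetric operad on one binary operation -/

section Operad

variable (F : Type*) [Field F]

/-- The arity `n` component of the free symmetric operad generated by one binary operation with no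
symmetry: the vector space with basis the multilinear nonassociative monomials in `a₁, …, aₙ`. -/
abbrev FreeOperad (n : ℕ) : Type _ := Monomial n →₀ F

/-- The `Sₙ`-module structure on the arity `n` component, by renaming arguments,
`σ • w(a₁, …, aₙ) = w(a_{σ(1)}, …, a_{σ(n)})`. The right module structure is
`w · σ = σ⁻¹ • w`. -/
def permRep (n : ℕ) : Representation F (Equiv.Perm (Fin n)) (FreeOperad F n) where
  toFun σ := Finsupp.lmapDomain F F (Monomial.relabel σ)
  map_one' := by
    rw [show Monomial.relabel (1 : Equiv.Perm (Fin n)) = id from funext Monomial.relabel_one,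
      Finsupp.lmapDomain_id]
    rfl
  map_mul' σ τ := by
    rw [show Monomial.relabel (σ * τ) = Monomial.relabel σ ∘ Monomial.relabel τ from
      funext (Monomial.relabel_mul σ τ), Finsupp.lmapDomain_comp]
    rfl

variable {F}

/-- Partial composition `p ∘ᵢ q` in the free operad, the bilinear extension of the composition of
monomials. -/
def comp {n m : ℕ} (i : Fin (n + 1)) :
    FreeOperad F (n + 1) →ₗ[F] FreeOperad F m →ₗ[F] FreeOperad F (n + m) :=
  Finsupp.lsum F fun w => LinearMap.toSpanSingleton F _
    (Finsupp.lmapDomain F F (Monomial.comp i w))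

/-- An operad ideal of the free operad: a family of `Sₙ`-submodules closed under composition, on
either side, with arbitrary elements. -/
structure IsOperadIdeal (J : ∀ n : ℕ, Submodule F (FreeOperad F n)) : Prop where
  perm_mem : ∀ (n : ℕ) (σ : Equiv.Perm (Fin n)) (p : FreeOperad F n),
    p ∈ J n → permRep F n σ p ∈ J n
  comp_mem_left : ∀ (n m : ℕ) (i : Fin (n + 1)) (p : FreeOperad F (n + 1)) (q : FreeOperad F m),
    p ∈ J (n + 1) → comp i p q ∈ J (n + m)
  comp_mem_right : ∀ (n m : ℕ) (i : Fin (n + 1)) (p : FreeOperad F (n + 1)) (q : FreeOperad F m),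
    q ∈ J m → comp i p q ∈ J (n + m)

/-- The operad ideal generated by one quadratic (arity three) relation: the intersection of all
operad ideals that contain it. -/
def idealGen (ρ : FreeOperad F 3) (n : ℕ) : Submodule F (FreeOperad F n) :=
  ⨅ (J : ∀ n : ℕ, Submodule F (FreeOperad F n)) (_ : IsOperadIdeal J) (_ : ρ ∈ J 3), J n

theorem mem_idealGen {ρ : FreeOperad F 3} {n : ℕ} {p : FreeOperad F n} :
    p ∈ idealGen ρ n ↔
      ∀ J : ∀ n : ℕ, Submodule F (FreeOperad F n), IsOperadIdeal J → ρ ∈ J 3 → p ∈ J n := by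
  simp [idealGen, Submodule.mem_iInf]

theorem isOperadIdeal_idealGen (ρ : FreeOperad F 3) : IsOperadIdeal (idealGen ρ) where
  perm_mem n σ p hp := mem_idealGen.2 fun J hJ hρ =>
    hJ.perm_mem n σ p (mem_idealGen.1 hp J hJ hρ)
  comp_mem_left n m i p q hp := mem_idealGen.2 fun J hJ hρ =>
    hJ.comp_mem_left n m i p q (mem_idealGen.1 hp J hJ hρ)
  comp_mem_right n m i p q hq := mem_idealGen.2 fun J hJ hρ =>
    hJ.comp_mem_right n m i p q (mem_idealGen.1 hq J hJ hρ)

/-- The arity `n` component of the quotient of the free operad by the ideal generated by `ρ`. -/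
abbrev QuotientOperad (ρ : FreeOperad F 3) (n : ℕ) : Type _ := FreeOperad F n ⧸ idealGen ρ n

/-- The `Sₙ`-module structure on the arity `n` component of the quotient operad. -/
def quotientRep (ρ : FreeOperad F 3) (n : ℕ) :
    Representation F (Equiv.Perm (Fin n)) (QuotientOperad ρ n) :=
  (permRep F n).quotient (idealGen ρ n) fun σ p hp =>
    (isOperadIdeal_idealGen ρ).perm_mem n σ p hp

/-- The relation `ρ` is regular: for all `n ≥ 1` the arity `n` component of the operad that it
defines is isomorphic to the regular module `F Sₙ`. -/
def IsRegular (ρ : FreeOperad F 3) : Prop :=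
  ∀ n : ℕ, 1 ≤ n → Nonempty
    (Representation.Equiv (quotientRep ρ n) (Representation.leftRegular F (Equiv.Perm (Fin n))))

/-! ### Relations of arity three -/

instance {n : ℕ} (w : FreeMagma (Fin n)) : Decidable (IsMultilinear w) :=
  inferInstanceAs (Decidable (letters w = Finset.univ.val))

variable (F) in
/-- The monomial `(aᵢ aⱼ) aₖ` of arity three, where `i, j, k` are the three indices in some order;
the arguments `a₁, a₂, a₃` have the indices `0, 1, 2`. -/
def lmon (i j k : Fin 3) (h : IsMultilinear (.of i * .of j * .of k) := by decide) :
    FreeOperad F 3 :=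
  Finsupp.single ⟨.of i * .of j * .of k, h⟩ 1

variable (F) in
/-- The monomial `aᵢ (aⱼ aₖ)` of arity three. -/
def rmon (i j k : Fin 3) (h : IsMultilinear (.of i * (.of j * .of k)) := by decide) :
    FreeOperad F 3 :=
  Finsupp.single ⟨.of i * (.of j * .of k), h⟩ 1

/-- The relation `(a₁a₂)a₃ = x₁ a₁(a₂a₃) + x₂ a₁(a₃a₂) + x₃ a₂(a₁a₃) + x₄ a₂(a₃a₁) +
x₅ a₃(a₁a₂) + x₆ a₃(a₂a₁)`, as the difference of its two sides. -/
def lrRelation (x₁ x₂ x₃ x₄ x₅ x₆ : F) : FreeOperad F 3 :=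
  lmon F 0 1 2 -
    (x₁ • rmon F 0 1 2 + x₂ • rmon F 0 2 1 + x₃ • rmon F 1 0 2 + x₄ • rmon F 1 2 0 +
      x₅ • rmon F 2 0 1 + x₆ • rmon F 2 1 0)

variable (F) in
/-- The left-nilpotent identity `(a₁a₂)a₃ = 0`. -/
def leftNilpotentRelation : FreeOperad F 3 := lmon F 0 1 2

variable (F) in
/-- Associativity `(a₁a₂)a₃ = a₁(a₂a₃)`. -/
def associativeRelation : FreeOperad F 3 := lmon F 0 1 2 - rmon F 0 1 2

variable (F) in
/-- The (right) Zinbiel identity `(a₁a₂)a₃ = a₁(a₂a₃) + a₁(a₃a₂)`. -/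
def zinbielRelation : FreeOperad F 3 := lmon F 0 1 2 - (rmon F 0 1 2 + rmon F 0 2 1)

variable (F) in
/-- The (left) Leibniz identity `(a₁a₂)a₃ = a₁(a₂a₃) - a₂(a₁a₃)`. -/
def leibnizRelation : FreeOperad F 3 := lmon F 0 1 2 - (rmon F 0 1 2 - rmon F 1 0 2)

end Operad

end LROperad

end

/-! When `x₅ = x₆ = 0`, the relation expands a product `(xr)v`, where `x` is a letter, into
products in which `x` stands outside or the left factor is shorter. Hence the `n!` right-normed
monomials span `𝒪ₓ(n)`, and `x` is regular if and only if they are linearly independent for every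
`n`. All computations take place in algebras rather than in the operad: `𝒪ₓ(n)` is the multilinear
part of the relatively free algebra on `n` letters.

Sufficiency: it is enough to find one algebra that satisfies the relation and in which the values of
the right-normed monomials are visibly independent. When `x₂ = x₄ = 0` this is `R × R` with the
product `(a, m)(b, n) = (x₁ ab + x₃ ba, an)`, where `R` is a free associative algebra. For the
Zinbiel identity it is the algebra of noncommutative power series under the half-shuffle.

Necessity: the monomial `((ab)c)d` can be expanded in two ways. Comparing the coefficients of the
right-normed monomials in both results gives polynomial equations in `x₁, …, x₄`, which only the
four points solve.
-/

noncomputable section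

namespace LROperad

variable {F : Type*} [Field F]

section Words

variable {X Y A B : Type*} [Mul A] [Mul B]

theorem letters_of (x : X) : letters (.of x) = {x} := rfl

theorem letters_mul (u v : FreeMagma X) : letters (u * v) = letters u + letters v := rfl

theorem lift_congr {f g : X → A} {w : FreeMagma X} (h : ∀ x ∈ letters w, f x = g x) :
    FreeMagma.lift f w = FreeMagma.lift g w := by
  induction w with
  | ih1 x => exact h x (Multiset.mem_singleton_self x)
  | ih2 u v hu hv =>
    simp only [letters_mul, Multiset.mem_add] at h
    rw [map_mul, map_mul, hu fun x hx => h x (.inl hx), hv fun x hx => h x (.inr hx)]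

theorem map_lift (φ : A →ₙ* B) (f : X → A) (w : FreeMagma X) :
    φ (FreeMagma.lift f w) = FreeMagma.lift (φ ∘ f) w :=
  DFunLike.congr_fun (FreeMagma.hom_ext (f := φ.comp (FreeMagma.lift f))
    (g := FreeMagma.lift (φ ∘ f)) (by ext x; simp)) w

theorem lift_map (f : Y → A) (g : X → Y) (w : FreeMagma X) :
    FreeMagma.lift f (FreeMagma.map g w) = FreeMagma.lift (f ∘ g) w :=
  (map_lift (FreeMagma.lift f) (FreeMagma.of ∘ g) w).trans <| by
    rw [← Function.comp_assoc, FreeMagma.lift_comp_of]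

/-- The arguments of a partial composition `p ∘ᵢ q`, split into the `n` arguments that go directly
to `p` (on the left) and the `m` arguments that go to `q` (on the right). -/
def argEquiv {n : ℕ} (i : Fin (n + 1)) (m : ℕ) : Fin n ⊕ Fin m ≃ Fin (n + m) :=
  Equiv.ofBijective
    (Sum.elim (fun j => if j.castSucc < i then j.castAdd m else j.addNat m)
      fun k => ⟨i + k, by omega⟩)
    ((Fintype.bijective_iff_injective_and_card _).2 ⟨by
      rintro (j | j) (k | k) h <;>
        simp only [Sum.elim_inl, Sum.elim_inr, Sum.inl.injEq, Sum.inr.injEq, reduceCtorEq]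
          at h ⊢ <;>
        (try split_ifs at h) <;>
        simp only [Fin.ext_iff, Fin.lt_def, Fin.val_castSucc, Fin.val_castAdd, Fin.val_addNat]
          at * <;>
        omega, by simp⟩)

theorem substLetter_self {n m : ℕ} (i : Fin (n + 1)) (v : FreeMagma (Fin m)) :
    substLetter i v i = FreeMagma.map (argEquiv i m ∘ Sum.inr) v := by
  simp only [substLetter, lt_irrefl, dite_false]
  rfl

theorem substLetter_succAbove {n m : ℕ} (i : Fin (n + 1)) (v : FreeMagma (Fin m)) (j : Fin n) :
    substLetter i v (i.succAbove j) = .of (argEquiv i m (.inl j)) := by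
  by_cases h : j.castSucc < i
  · rw [Fin.succAbove_of_castSucc_lt i j h, substLetter, dif_pos h]
    exact congrArg FreeMagma.of (if_pos h).symm
  · have h' : i < j.succ := Fin.le_castSucc_iff.1 (not_lt.1 h)
    rw [Fin.succAbove_of_le_castSucc i j (not_lt.1 h), substLetter, dif_neg h'.not_gt, dif_pos h']
    exact congrArg FreeMagma.of (if_neg h).symm

theorem lift_substLetter {n m : ℕ} (i : Fin (n + 1)) (v : FreeMagma (Fin m))
    (f : Fin (n + m) → A) :
    FreeMagma.lift f ∘ substLetter i v =
      i.insertNth (α := fun _ => A) (FreeMagma.lift (f ∘ argEquiv i m ∘ Sum.inr) v)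
        (f ∘ argEquiv i m ∘ Sum.inl) := by
  refine (Fin.insertNth_eq_iff.2 ⟨?_, funext fun j => ?_⟩).symm
  · rw [Function.comp_apply, substLetter_self, lift_map]
  · simp [Fin.removeNth, substLetter_succAbove]

end Words

section LiftUpdate

variable {R X A : Type*} [CommSemiring R]
  [NonUnitalNonAssocSemiring A] [Module R A] [IsScalarTower R A A] [SMulCommClass R A A]

theorem exists_linearMap_lift_update [DecidableEq X] (f : X → A) {x : X} {w : FreeMagma X}
    (hw : (letters w).Nodup) (hx : x ∈ letters w) :
    ∃ L : A →ₗ[R] A, ∀ a, FreeMagma.lift (Function.update f x a) w = L a := by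
  induction w with
  | ih1 y =>
    obtain rfl : x = y := Multiset.mem_singleton.1 hx
    exact ⟨LinearMap.id, fun a => by simp⟩
  | ih2 u v hu hv =>
    obtain ⟨hu_nodup, hv_nodup, hdisj⟩ := Multiset.nodup_add.1 hw
    have lift_update_of_notMem {t : FreeMagma X} (ht : x ∉ letters t) (a : A) :
        FreeMagma.lift (Function.update f x a) t = FreeMagma.lift f t :=
      lift_congr fun y hy => Function.update_of_ne (ne_of_mem_of_not_mem hy ht) _ _
    rcases Multiset.mem_add.1 hx with hxu | hxv
    · obtain ⟨L, hL⟩ := hu hu_nodup hxu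
      refine ⟨LinearMap.mulRight R (FreeMagma.lift f v) ∘ₗ L, fun a => ?_⟩
      rw [map_mul, hL, lift_update_of_notMem (Multiset.disjoint_left.1 hdisj hxu)]
      rfl
    · obtain ⟨L, hL⟩ := hv hv_nodup hxv
      refine ⟨LinearMap.mulLeft R (FreeMagma.lift f u) ∘ₗ L, fun a => ?_⟩
      rw [map_mul, hL, lift_update_of_notMem (Multiset.disjoint_right.1 hdisj hxv)]
      rfl

end LiftUpdate

section Evaluation

variable {A B : Type*}
  [NonUnitalNonAssocRing A] [Module F A] [IsScalarTower F A A] [SMulCommClass F A A]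
  [NonUnitalNonAssocRing B] [Module F B] [IsScalarTower F B B] [SMulCommClass F B B]

/-- The multilinear operation on an algebra that a multilinear monomial defines. -/
def Monomial.eval {n : ℕ} (w : Monomial n) : MultilinearMap F (fun _ : Fin n => A) A where
  toFun f := FreeMagma.lift f w.1
  map_update_add' f i a b := by
    obtain ⟨hw, hi⟩ := (isMultilinear_iff w.1).1 w.2
    obtain ⟨L, hL⟩ := exists_linearMap_lift_update (R := F) f hw (hi i)
    rw [hL, hL, hL, map_add]
  map_update_smul' f i c a := by
    obtain ⟨hw, hi⟩ := (isMultilinear_iff w.1).1 w.2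
    obtain ⟨L, hL⟩ := exists_linearMap_lift_update (R := F) f hw (hi i)
    rw [hL, hL, map_smul]

/-- The action of the free operad on an algebra `A`: an element of arity `n` acts as an `n`-linear
operation. -/
def eval {n : ℕ} : FreeOperad F n →ₗ[F] MultilinearMap F (fun _ : Fin n => A) A :=
  Finsupp.linearCombination F Monomial.eval

theorem eval_single {n : ℕ} (w : Monomial n) (c : F) (f : Fin n → A) :
    eval (Finsupp.single w c) f = c • FreeMagma.lift f w.1 := by
  rw [eval, Finsupp.linearCombination_single]
  rfl

theorem permRep_single {n : ℕ} (σ : Equiv.Perm (Fin n)) (w : Monomial n) (c : F) :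
    permRep F n σ (Finsupp.single w c) = Finsupp.single (w.relabel σ) c :=
  Finsupp.mapDomain_single

theorem comp_single {n m : ℕ} (i : Fin (n + 1)) (w : Monomial (n + 1)) (v : Monomial m) (c d : F) :
    comp i (Finsupp.single w c) (Finsupp.single v d) = Finsupp.single (w.comp i v) (c * d) := by
  simp [comp]

theorem eval_permRep {n : ℕ} (σ : Equiv.Perm (Fin n)) (p : FreeOperad F n) (f : Fin n → A) :
    eval (permRep F n σ p) f = eval p (f ∘ σ) := by
  induction p using Finsupp.induction_linear with
  | zero => simp
  | add p q hp hq => simp only [map_add, add_apply, hp, hq]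
  | single w c => rw [permRep_single, eval_single, eval_single, Monomial.relabel, lift_map]

theorem eval_comp_apply {n : ℕ} (φ : A →ₙₐ[F] B) (p : FreeOperad F n) (f : Fin n → A) :
    eval p (φ ∘ f) = φ (eval p f) := by
  induction p using Finsupp.induction_linear with
  | zero => simp
  | add p q hp hq => simp only [map_add, add_apply, hp, hq]
  | single w c =>
    rw [eval_single, eval_single, map_smul]
    exact congrArg _ (map_lift (φ : A →ₙ* B) f w.1).symm

theorem eval_comp {n m : ℕ} (i : Fin (n + 1)) (p : FreeOperad F (n + 1)) (q : FreeOperad F m)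
    (f : Fin (n + m) → A) :
    eval (comp i p q) f = eval p (i.insertNth (α := fun _ => A)
      (eval q (f ∘ argEquiv i m ∘ Sum.inr)) (f ∘ argEquiv i m ∘ Sum.inl)) := by
  have eval_insertNth (p : FreeOperad F (n + 1)) (a : A) (b : Fin n → A) :
      eval p (i.insertNth (α := fun _ => A) a b) =
        (eval p).toLinearMap (i.insertNth (α := fun _ => A) 0 b) i a := by
    rw [MultilinearMap.toLinearMap_apply, Fin.update_insertNth]
  induction p using Finsupp.induction_linear with
  | zero => simp
  | add p p' hp hp' => simp only [map_add, LinearMap.add_apply, add_apply, hp, hp']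
  | single w c =>
    rw [eval_insertNth]
    induction q using Finsupp.induction_linear with
    | zero => simp only [map_zero, zero_apply]
    | add q q' hq hq' => simp only [map_add, add_apply, hq, hq']
    | single v d =>
      rw [comp_single, eval_single, eval_single, map_smul, ← eval_insertNth, eval_single,
        ← lift_substLetter, smul_smul, mul_comm, Monomial.comp]
      exact congrArg _ (map_lift _ _ _)

theorem eval_insertNth_eval {n m : ℕ} (i : Fin (n + 1)) (p : FreeOperad F (n + 1))
    (q : FreeOperad F m) (a : Fin m → A) (b : Fin n → A) :
    eval p (i.insertNth (α := fun _ => A) (eval q a) b) =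
      eval (comp i p q) (Sum.elim b a ∘ (argEquiv i m).symm) := by
  rw [eval_comp]
  congr <;> ext <;> simp

variable (F A) in
/-- The identities of arity `n` of an algebra: the elements of the free operad that act on it by
zero. -/
def identities (n : ℕ) : Submodule F (FreeOperad F n) :=
  LinearMap.ker (eval (A := A))

theorem mem_identities {n : ℕ} {p : FreeOperad F n} :
    p ∈ identities F A n ↔ ∀ f : Fin n → A, eval p f = 0 :=
  MultilinearMap.ext_iff

variable (F A) in
theorem isOperadIdeal_identities : IsOperadIdeal (identities F A) where
  perm_mem n σ p hp := mem_identities.2 fun f => by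
    rw [eval_permRep, mem_identities.1 hp]
  comp_mem_left n m i p q hp := mem_identities.2 fun f => by
    rw [eval_comp, mem_identities.1 hp]
  comp_mem_right n m i p q hq := mem_identities.2 fun f => by
    rw [eval_comp, mem_identities.1 hq]
    exact MultilinearMap.map_coord_zero _ i (Fin.insertNth_apply_same ..)

end Evaluation

section OfBilinear

variable {R A : Type*} [CommSemiring R] [AddCommGroup A] [Module R A]

/-- The algebra whose underlying vector space is `A` and whose product is the bilinear map `μ`. -/
def OfBilinear (_μ : A →ₗ[R] A →ₗ[R] A) : Type _ := A

namespace OfBilinear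

variable (μ : A →ₗ[R] A →ₗ[R] A)

instance : AddCommGroup (OfBilinear μ) := inferInstanceAs (AddCommGroup A)

instance : Module R (OfBilinear μ) := inferInstanceAs (Module R A)

/-- The identification of `A`, as a vector space, with the algebra that `μ` makes of it. -/
def of : A ≃ₗ[R] OfBilinear μ := LinearEquiv.refl R A

instance : NonUnitalNonAssocRing (OfBilinear μ) where
  mul a b := of μ (μ ((of μ).symm a) ((of μ).symm b))
  left_distrib a b c := by
    change of μ _ = of μ _ + of μ _
    simp only [map_add]
  right_distrib a b c := by
    change of μ _ = of μ _ + of μ _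
    simp only [map_add, LinearMap.add_apply]
  zero_mul a := by
    change of μ _ = 0
    simp only [map_zero, LinearMap.zero_apply]
  mul_zero a := by
    change of μ _ = 0
    simp only [map_zero]

theorem mul_def (a b : OfBilinear μ) : a * b = of μ (μ ((of μ).symm a) ((of μ).symm b)) := rfl

instance : IsScalarTower R (OfBilinear μ) (OfBilinear μ) :=
  ⟨fun c a b => by simp only [smul_eq_mul, mul_def, map_smul, LinearMap.smul_apply]⟩

instance : SMulCommClass R (OfBilinear μ) (OfBilinear μ) :=
  ⟨fun c a b => by simp only [smul_eq_mul, mul_def, map_smul]⟩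

end OfBilinear

end OfBilinear

section VerbalQuotient

variable (F) in
/-- The product `a₁a₂`, the generator of the free operad. -/
def binaryProduct : FreeOperad F 2 := Finsupp.single ⟨.of 0 * .of 1, by decide⟩ 1

variable {A : Type*}
  [NonUnitalNonAssocRing A] [Module F A] [IsScalarTower F A A] [SMulCommClass F A A]

theorem eval_binaryProduct (f : Fin 2 → A) : eval (binaryProduct F) f = f 0 * f 1 := by
  rw [binaryProduct, eval_single, one_smul]
  simp

/-- The verbal ideal of an algebra that belongs to an operad ideal `J`: the span of all values of
elements of `J`. -/
def verbalIdeal (J : ∀ n, Submodule F (FreeOperad F n)) (A : Type*)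
    [NonUnitalNonAssocRing A] [Module F A] [IsScalarTower F A A] [SMulCommClass F A A] :
    Submodule F A :=
  Submodule.span F {a | ∃ n, ∃ p ∈ J n, ∃ f : Fin n → A, eval p f = a}

variable {J : ∀ n, Submodule F (FreeOperad F n)} (hJ : IsOperadIdeal J)

theorem eval_mem_verbalIdeal {n : ℕ} {p : FreeOperad F n} (hp : p ∈ J n) (f : Fin n → A) :
    eval p f ∈ verbalIdeal J A :=
  Submodule.subset_span ⟨n, p, hp, f, rfl⟩

include hJ in
theorem mul_mem_verbalIdeal_left (a : A) {b : A} (hb : b ∈ verbalIdeal J A) :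
    a * b ∈ verbalIdeal J A := by
  suffices verbalIdeal J A ≤ (verbalIdeal J A).comap (LinearMap.mulLeft F a) from this hb
  refine Submodule.span_le.2 ?_
  rintro _ ⟨n, p, hp, f, rfl⟩
  have h := eval_insertNth_eval 1 (binaryProduct F) p f fun _ : Fin 1 => a
  rw [eval_binaryProduct] at h
  change a * eval p f ∈ verbalIdeal J A
  exact h ▸ eval_mem_verbalIdeal (hJ.comp_mem_right _ _ _ _ _ hp) _

include hJ in
theorem mul_mem_verbalIdeal_right {a : A} (ha : a ∈ verbalIdeal J A) (b : A) :
    a * b ∈ verbalIdeal J A := by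
  suffices verbalIdeal J A ≤ (verbalIdeal J A).comap (LinearMap.mulRight F b) from this ha
  refine Submodule.span_le.2 ?_
  rintro _ ⟨n, p, hp, f, rfl⟩
  have h := eval_insertNth_eval 0 (binaryProduct F) p f fun _ : Fin 1 => b
  rw [eval_binaryProduct] at h
  change eval p f * b ∈ verbalIdeal J A
  exact h ▸ eval_mem_verbalIdeal (hJ.comp_mem_right _ _ _ _ _ hp) _

variable (A) in
/-- The product of the quotient of an algebra by a verbal ideal. -/
def verbalQuotientMul :
    A ⧸ verbalIdeal J A →ₗ[F] A ⧸ verbalIdeal J A →ₗ[F] A ⧸ verbalIdeal J A :=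
  LinearMap.liftQ₂ _ _ ((LinearMap.mul F A).compr₂ (verbalIdeal J A).mkQ)
    (fun _ ha => LinearMap.ext fun b =>
      (Submodule.Quotient.mk_eq_zero _).2 (mul_mem_verbalIdeal_right hJ ha b))
    fun _ hb => LinearMap.ext fun a =>
      (Submodule.Quotient.mk_eq_zero _).2 (mul_mem_verbalIdeal_left hJ a hb)

variable (A) in
/-- The quotient of an algebra by the verbal ideal of an operad ideal `J`, that is, its largest
quotient algebra in which the elements of `J` are identities. -/
abbrev VerbalQuotient : Type _ := OfBilinear (verbalQuotientMul A hJ)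

variable (A) in
/-- The projection of an algebra onto its verbal quotient. -/
def toVerbalQuotient : A →ₙₐ[F] VerbalQuotient A hJ where
  __ := (OfBilinear.of (verbalQuotientMul A hJ)).toLinearMap ∘ₗ (verbalIdeal J A).mkQ
  map_mul' _ _ := rfl
  map_zero' := rfl

theorem toVerbalQuotient_surjective : Function.Surjective (toVerbalQuotient A hJ) :=
  Submodule.mkQ_surjective _

variable (A) in
theorem le_identities_verbalQuotient (n : ℕ) : J n ≤ identities F (VerbalQuotient A hJ) n :=
  fun p hp => mem_identities.2 fun f => by
    obtain ⟨g, rfl⟩ := (toVerbalQuotient_surjective hJ).comp_left f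
    rw [eval_comp_apply]
    exact (Submodule.Quotient.mk_eq_zero _).2 (eval_mem_verbalIdeal hp g)

end VerbalQuotient

section MultilinearPart

variable {J : ∀ n, Submodule F (FreeOperad F n)} (hJ : IsOperadIdeal J)

include hJ in
/- Composing `p` with the product at an argument that is a product of two words splits that
argument, until only letters are left. -/
theorem exists_eval_words_eq_eval_letters {X A : Type*} [NonUnitalNonAssocRing A] [Module F A]
    [IsScalarTower F A A] [SMulCommClass F A A] (φ : FreeMagma X →ₙ* A) {n : ℕ}
    {p : FreeOperad F n} (hp : p ∈ J n) (f : Fin n → FreeMagma X) :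
    ∃ m, ∃ q ∈ J m, ∃ g : Fin m → X, eval p (φ ∘ f) = eval q (φ ∘ .of ∘ g) := by
  induction h : ∑ k, ((f k).length - 1) using Nat.strong_induction_on generalizing n with
  | _ N ih =>
    subst h
    by_cases hf : ∀ k, ∃ x, .of x = f k
    · choose g hg using hf
      exact ⟨n, p, hp, g, by rw [show FreeMagma.of ∘ g = f from funext hg]⟩
    obtain ⟨i, hi⟩ := not_forall.1 hf
    obtain ⟨u, v, huv⟩ : ∃ u v, f i = u * v := by
      cases hfi : f i with
      | of x => exact absurd ⟨x, hfi.symm⟩ hi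
      | mul u v => exact ⟨u, v, rfl⟩
    obtain ⟨n, rfl⟩ := Nat.exists_eq_succ_of_ne_zero i.pos.ne'
    let f' : Fin (n + 2) → FreeMagma X :=
      Sum.elim (i.removeNth f) ![u, v] ∘ (argEquiv i 2).symm
    have eval_split : eval p (φ ∘ f) = eval (comp i p (binaryProduct F)) (φ ∘ f') := by
      rw [eval_comp, eval_binaryProduct]
      congr 1
      refine (Fin.insertNth_eq_iff.2 ⟨?_, funext fun j => ?_⟩).symm <;>
        simp [f', huv, Fin.removeNth]
    have length_lt : ∑ k, ((f' k).length - 1) < ∑ k, ((f k).length - 1) := by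
      have hu := u.length_pos
      have hv := v.length_pos
      rw [Fin.sum_univ_succAbove _ i, huv, ← (argEquiv i 2).sum_comp]
      simp only [f', Fintype.sum_sum_type, Function.comp_apply, Equiv.symm_apply_apply,
        Sum.elim_inl, Sum.elim_inr, Fin.sum_univ_two, Fin.removeNth, Matrix.cons_val_zero,
        Matrix.cons_val_one]
      change _ < u.length + v.length - 1 + _
      omega
    rw [eval_split]
    exact ih _ length_lt (hJ.comp_mem_left n 2 i p _ hp) f' rfl

/-- The multilinear part of an element of the free nonassociative algebra on `n` letters. -/
def multilinearPart (n : ℕ) : FreeNonUnitalNonAssocAlgebra F (Fin n) →ₗ[F] FreeOperad F n :=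
  (MonoidAlgebra.basis (FreeMagma (Fin n)) F).constr F fun w =>
    if h : IsMultilinear w then Finsupp.single ⟨w, h⟩ 1 else 0

theorem multilinearPart_ofMagma {n : ℕ} (w : FreeMagma (Fin n)) :
    multilinearPart n (MonoidAlgebra.ofMagma F _ w) =
      if h : IsMultilinear w then Finsupp.single ⟨w, h⟩ 1 else 0 :=
  Module.Basis.constr_basis ..

theorem multilinearPart_eval_single {n m : ℕ} (w : Monomial m) (c : F) (g : Fin m → Fin n) :
    multilinearPart n (eval (.single w c) (MonoidAlgebra.ofMagma F _ ∘ .of ∘ g)) =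
      if h : IsMultilinear (FreeMagma.map g w.1) then
        Finsupp.single ⟨FreeMagma.map g w.1, h⟩ c
      else 0 := by
  rw [eval_single, ← map_lift, map_smul]
  refine (congrArg (c • ·) (multilinearPart_ofMagma (FreeMagma.map g w.1))).trans ?_
  split_ifs
  · rw [Finsupp.smul_single_one]
  · rw [smul_zero]

theorem multilinearPart_eval_perm {n : ℕ} (p : FreeOperad F n) (σ : Equiv.Perm (Fin n)) :
    multilinearPart n (eval p (MonoidAlgebra.ofMagma F _ ∘ .of ∘ σ)) = permRep F n σ p := by
  induction p using Finsupp.induction_linear with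
  | zero => simp
  | add p q hp hq => simp only [map_add, add_apply, hp, hq]
  | single w c =>
    rw [multilinearPart_eval_single, permRep_single]
    exact dif_pos (w.relabel σ).2

theorem multilinearPart_eval_of_not_bijective {n m : ℕ} (p : FreeOperad F m) {g : Fin m → Fin n}
    (hg : ¬ g.Bijective) :
    multilinearPart n (eval p (MonoidAlgebra.ofMagma F _ ∘ .of ∘ g)) = 0 := by
  induction p using Finsupp.induction_linear with
  | zero => simp
  | add p q hp hq => simp only [map_add, add_apply, hp, hq, add_zero]
  | single w c =>
    refine (multilinearPart_eval_single w c g).trans (dif_neg fun h => hg ?_)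
    obtain ⟨hnodup, hmem⟩ := (isMultilinear_iff _).1 h
    rw [letters_map, w.2] at hnodup hmem
    exact ⟨fun j k =>
        Multiset.inj_on_of_nodup_map hnodup j (Finset.mem_univ j) k (Finset.mem_univ k),
      fun k => (Multiset.mem_map.1 (hmem k)).imp fun _ => And.right⟩

include hJ in
theorem multilinearPart_eval_mem {m n : ℕ} {p : FreeOperad F m} (hp : p ∈ J m)
    (f : Fin m → FreeNonUnitalNonAssocAlgebra F (Fin n)) :
    multilinearPart n (eval p f) ∈ J n := by
  suffices h : ((J n).mkQ ∘ₗ multilinearPart n).compMultilinearMap (eval p) = 0 from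
    (Submodule.Quotient.mk_eq_zero _).1 (congrArg (· f) h)
  refine Module.Basis.ext_multilinear (fun _ => MonoidAlgebra.basis _ F) fun w => ?_
  obtain ⟨k, q, hq, g, hg⟩ :=
    exists_eval_words_eq_eval_letters hJ (MonoidAlgebra.ofMagma F _) hp w
  refine (Submodule.Quotient.mk_eq_zero _).2 ?_
  change multilinearPart n (eval p (MonoidAlgebra.ofMagma F _ ∘ w)) ∈ J n
  rw [hg]
  by_cases hbij : g.Bijective
  · obtain rfl : k = n := by simpa using Fintype.card_of_bijective hbij
    exact multilinearPart_eval_perm q (Equiv.ofBijective g hbij) ▸ hJ.perm_mem k _ q hq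
  · exact multilinearPart_eval_of_not_bijective q hbij ▸ zero_mem _

/-- The relatively free algebra on `n` letters of the variety of algebras that satisfy the
identities in an operad ideal. -/
abbrev RelativelyFree (n : ℕ) : Type _ :=
  VerbalQuotient (FreeNonUnitalNonAssocAlgebra F (Fin n)) hJ

/-- The generators of the relatively free algebra. -/
def RelativelyFree.gen {n : ℕ} (i : Fin n) : RelativelyFree hJ n :=
  toVerbalQuotient _ hJ (FreeNonUnitalNonAssocAlgebra.of F i)

/-- The multilinear part of an element of the relatively free algebra, as an element of the
quotient operad. -/
def multilinearClass (n : ℕ) : RelativelyFree hJ n →ₗ[F] FreeOperad F n ⧸ J n :=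
  (verbalIdeal J _).liftQ ((J n).mkQ ∘ₗ multilinearPart n) (Submodule.span_le.2 <| by
    rintro _ ⟨m, p, hp, f, rfl⟩
    exact (Submodule.Quotient.mk_eq_zero _).2 (multilinearPart_eval_mem hJ hp f)) ∘ₗ
  (OfBilinear.of _).symm.toLinearMap

theorem multilinearClass_lift_gen {n : ℕ} (w : Monomial n) :
    multilinearClass hJ n (FreeMagma.lift (RelativelyFree.gen hJ) w.1) =
      (J n).mkQ (Finsupp.single w 1) := by
  have lift_gen : FreeMagma.lift (RelativelyFree.gen hJ) =
      (toVerbalQuotient (FreeNonUnitalNonAssocAlgebra F (Fin n)) hJ).toMulHom.comp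
        (MonoidAlgebra.ofMagma F _) :=
    FreeMagma.hom_ext (FreeMagma.lift_comp_of _)
  rw [lift_gen]
  exact congrArg (J n).mkQ ((multilinearPart_ofMagma w.1).trans (dif_pos w.2))

end MultilinearPart

section RightNormed

variable {X Y : Type*}

/-- The right-normed word `a₁(a₂(⋯(aₖ z)))`, where `l = [a₁, …, aₖ]`. -/
def rightNormed (l : List X) (z : X) : FreeMagma X :=
  l.foldr (fun a w => .of a * w) (.of z)

theorem rightNormed_cons (a : X) (l : List X) (z : X) :
    rightNormed (a :: l) z = .of a * rightNormed l z := rfl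

theorem letters_rightNormed (l : List X) (z : X) :
    letters (rightNormed l z) = (l ++ [z] : List X) := by
  induction l with
  | nil => rfl
  | cons a l ih => rw [rightNormed_cons, letters_mul, ih]; rfl

theorem map_rightNormed (f : X → Y) (l : List X) (z : X) :
    FreeMagma.map f (rightNormed l z) = rightNormed (l.map f) (f z) := by
  induction l with
  | nil => rfl
  | cons a l ih => rw [rightNormed_cons, map_mul, ih]; rfl

end RightNormed

section RightNormedSpan

variable {R X A : Type*} [CommSemiring R] [NonUnitalNonAssocSemiring A] [Module R A] {f : X → A}

variable (R) in
/-- The span of the values of the right-normed words with the multiset of letters `s`. -/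
def rightNormedSpan (f : X → A) (s : Multiset X) : Submodule R A :=
  .span R {a | ∃ l z, letters (rightNormed l z) = s ∧ FreeMagma.lift f (rightNormed l z) = a}

theorem rightNormedSpan_le {s : Multiset X} {V : Submodule R A} :
    rightNormedSpan R f s ≤ V ↔
      ∀ l z, letters (rightNormed l z) = s → FreeMagma.lift f (rightNormed l z) ∈ V :=
  Submodule.span_le.trans ⟨fun h l z hl => h ⟨l, z, hl, rfl⟩, by
    rintro h _ ⟨l, z, hl, rfl⟩
    exact h l z hl⟩

theorem lift_rightNormed_mem_rightNormedSpan (l : List X) (z : X) :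
    FreeMagma.lift f (rightNormed l z) ∈ rightNormedSpan R f (letters (rightNormed l z)) :=
  rightNormedSpan_le.1 le_rfl l z rfl

theorem letter_mul_mem_rightNormedSpan (x : X) {s : Multiset X} [SMulCommClass R A A]
    {a : A} (ha : a ∈ rightNormedSpan R f s) : f x * a ∈ rightNormedSpan R f ({x} + s) := by
  suffices rightNormedSpan R f s ≤
      (rightNormedSpan R f ({x} + s)).comap (LinearMap.mulLeft R (f x)) from this ha
  refine rightNormedSpan_le.2 ?_
  rintro l z rfl
  exact lift_rightNormed_mem_rightNormedSpan (x :: l) z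

end RightNormedSpan

section SatisfiesLR

variable {R X A : Type*} [CommSemiring R]
  [NonUnitalNonAssocSemiring A] [Module R A] [IsScalarTower R A A] [SMulCommClass R A A]
  {x₁ x₂ x₃ x₄ : R} {f : X → A}

variable (A) in
/-- The identity `(ab)c = x₁ a(bc) + x₂ a(cb) + x₃ b(ac) + x₄ b(ca)` holds in the algebra `A`. -/
def SatisfiesLR (x₁ x₂ x₃ x₄ : R) : Prop :=
  ∀ a b c : A, a * b * c =
    x₁ • (a * (b * c)) + x₂ • (a * (c * b)) + x₃ • (b * (a * c)) + x₄ • (b * (c * a))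

omit [IsScalarTower R A A] in
theorem SatisfiesLR.letter_mul_mul_mem_rightNormedSpan (h : SatisfiesLR A x₁ x₂ x₃ x₄) (x : X)
    {s t : Multiset X} {r v : A} (hrv : r * v ∈ rightNormedSpan R f (s + t))
    (hvr : v * r ∈ rightNormedSpan R f (s + t))
    (hrxv : r * (f x * v) ∈ rightNormedSpan R f ({x} + s + t))
    (hrvx : r * (v * f x) ∈ rightNormedSpan R f ({x} + s + t)) :
    f x * r * v ∈ rightNormedSpan R f ({x} + s + t) := by
  have hxrv := letter_mul_mem_rightNormedSpan x hrv
  have hxvr := letter_mul_mem_rightNormedSpan x hvr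
  rw [← Multiset.add_assoc] at hxrv hxvr
  rw [h]
  exact add_mem (add_mem (add_mem (Submodule.smul_mem _ x₁ hxrv) (Submodule.smul_mem _ x₂ hxvr))
    (Submodule.smul_mem _ x₃ hrxv)) (Submodule.smul_mem _ x₄ hrvx)

/- In the expansion of `(xr)v` the terms `r(xv)` and `r(vx)` have a shorter left factor, and all
products inside `x(rv)`, `x(vr)` and `vx` have fewer letters. -/
theorem SatisfiesLR.mul_mem_rightNormedSpan (h : SatisfiesLR A x₁ x₂ x₃ x₄) (s t : Multiset X)
    {u v : A} (hu : u ∈ rightNormedSpan R f s) (hv : v ∈ rightNormedSpan R f t) :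
    u * v ∈ rightNormedSpan R f (s + t) := by
  suffices rightNormedSpan R f s ≤
      (rightNormedSpan R f (s + t)).comap (LinearMap.mulRight R v) from this hu
  refine rightNormedSpan_le.2 ?_
  rintro (_ | ⟨x, l⟩) z hl
  · exact hl ▸ letter_mul_mem_rightNormedSpan z hv
  have hr : FreeMagma.lift f (rightNormed l z) ∈
      rightNormedSpan R f (letters (rightNormed l z)) :=
    lift_rightNormed_mem_rightNormedSpan l z
  have card_pos : 0 < (letters (rightNormed l z)).card := by simp [letters_rightNormed]
  have card_eq : s.card = (letters (rightNormed l z)).card + 1 := by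
    simp [← hl, letters_rightNormed]
  simp only [Submodule.mem_comap, LinearMap.mulRight_apply, rightNormed_cons, letters_mul,
    letters_of, map_mul, FreeMagma.lift_of] at hl ⊢
  generalize letters (rightNormed l z) = s', FreeMagma.lift f (rightNormed l z) = r at *
  subst hl
  have mul_mem_of_tail {b : A} (hb : b ∈ rightNormedSpan R f ({x} + t)) :
      r * b ∈ rightNormedSpan R f ({x} + s' + t) := by
    rw [Multiset.add_comm {x} s', Multiset.add_assoc]
    exact h.mul_mem_rightNormedSpan s' _ hr hb
  have hvr : v * r ∈ rightNormedSpan R f (s' + t) := by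
    rw [Multiset.add_comm]
    exact h.mul_mem_rightNormedSpan t s' hv hr
  have hvx : v * f x ∈ rightNormedSpan R f ({x} + t) := by
    rw [Multiset.add_comm]
    exact h.mul_mem_rightNormedSpan t _ hv (lift_rightNormed_mem_rightNormedSpan [] x)
  exact h.letter_mul_mul_mem_rightNormedSpan x (h.mul_mem_rightNormedSpan s' t hr hv) hvr
    (mul_mem_of_tail (letter_mul_mem_rightNormedSpan x hv)) (mul_mem_of_tail hvx)
termination_by (s.card + t.card, s.card)
decreasing_by all_goals simp [Prod.lex_def]; omega

theorem SatisfiesLR.lift_mem_rightNormedSpan (h : SatisfiesLR A x₁ x₂ x₃ x₄) (w : FreeMagma X) :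
    FreeMagma.lift f w ∈ rightNormedSpan R f (letters w) := by
  induction w with
  | ih1 x => exact lift_rightNormed_mem_rightNormedSpan [] x
  | ih2 u v hu hv =>
    rw [map_mul]
    exact h.mul_mem_rightNormedSpan _ _ hu hv

end SatisfiesLR

section Identities

variable {A : Type*} [NonUnitalNonAssocRing A] [Module F A] [IsScalarTower F A A]
  [SMulCommClass F A A] {x₁ x₂ x₃ x₄ : F}

theorem eval_lrRelation (f : Fin 3 → A) :
    eval (lrRelation x₁ x₂ x₃ x₄ 0 0) f = f 0 * f 1 * f 2 -
      (x₁ • (f 0 * (f 1 * f 2)) + x₂ • (f 0 * (f 2 * f 1)) + x₃ • (f 1 * (f 0 * f 2)) +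
        x₄ • (f 1 * (f 2 * f 0))) := by
  simp [lrRelation, lmon, rmon, eval_single]

theorem lrRelation_mem_identities :
    lrRelation x₁ x₂ x₃ x₄ 0 0 ∈ identities F A 3 ↔ SatisfiesLR A x₁ x₂ x₃ x₄ := by
  simp only [mem_identities, eval_lrRelation, sub_eq_zero]
  exact ⟨fun h a b c => by simpa using h ![a, b, c], fun h f => h _ _ _⟩

theorem SatisfiesLR.idealGen_le_identities (h : SatisfiesLR A x₁ x₂ x₃ x₄) (n : ℕ) :
    idealGen (lrRelation x₁ x₂ x₃ x₄ 0 0) n ≤ identities F A n := fun _ hp =>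
  mem_idealGen.1 hp _ (isOperadIdeal_identities F A) (lrRelation_mem_identities.2 h)

end Identities

section Regularity

variable (ρ : FreeOperad F 3) {k : ℕ}

/-- The right-normed monomial `a_{σ(1)}(a_{σ(2)}(⋯(a_{σ(k)} a_{σ(k+1)})))`. -/
def rightNormedMonomial (σ : Equiv.Perm (Fin (k + 1))) : Monomial (k + 1) :=
  ⟨rightNormed (List.ofFn fun i : Fin k => σ i.castSucc) (σ (Fin.last k)), by
    rw [isMultilinear_iff, letters_rightNormed, ← List.concat_eq_append, ← List.ofFn_succ']
    exact ⟨List.nodup_ofFn.2 σ.injective, fun j => (List.mem_ofFn' _ _).2 (σ.surjective j)⟩⟩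

theorem relabel_rightNormedMonomial (τ σ : Equiv.Perm (Fin (k + 1))) :
    (rightNormedMonomial σ).relabel τ = rightNormedMonomial (τ * σ) :=
  Subtype.ext <| by
    simp only [Monomial.relabel, rightNormedMonomial, map_rightNormed, List.map_ofFn]
    rfl

theorem exists_rightNormedMonomial_eq {l : List (Fin (k + 1))} {z : Fin (k + 1)}
    (h : IsMultilinear (rightNormed l z)) :
    ∃ σ : Equiv.Perm (Fin (k + 1)), (rightNormedMonomial σ).1 = rightNormed l z := by
  obtain ⟨m, g, hg⟩ := (List.exists_iff_exists_tuple (P := (· = l ++ [z]))).1 ⟨_, rfl⟩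
  rw [IsMultilinear, letters_rightNormed, ← hg] at h
  obtain rfl : m = k + 1 := by simpa using congrArg Multiset.card h
  have hg_inj : Function.Injective g :=
    List.nodup_ofFn.1 (Multiset.coe_nodup.1 (h ▸ Finset.univ.nodup))
  refine ⟨Equiv.ofBijective g (Finite.injective_iff_bijective.1 hg_inj), ?_⟩
  rw [List.ofFn_succ', List.concat_eq_append] at hg
  obtain ⟨rfl, hz⟩ := List.append_inj' hg rfl
  obtain rfl := List.singleton_injective hz
  rfl

/-- The class of a right-normed monomial in the quotient operad. -/
def rightNormedClass (σ : Equiv.Perm (Fin (k + 1))) : QuotientOperad ρ (k + 1) :=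
  (idealGen ρ (k + 1)).mkQ (Finsupp.single (rightNormedMonomial σ) 1)

variable (k) in
/-- The homomorphism from the regular module that sends `σ` to `rightNormedClass ρ σ`. -/
def rightNormedMap :
    (Representation.leftRegular F (Equiv.Perm (Fin (k + 1)))).IntertwiningMap
      (quotientRep ρ (k + 1)) :=
  (Representation.leftRegularMapEquiv (quotientRep ρ (k + 1))).symm (rightNormedClass ρ 1)

theorem rightNormedMap_single (σ : Equiv.Perm (Fin (k + 1))) :
    rightNormedMap ρ k (MonoidAlgebra.single σ 1) = rightNormedClass ρ σ := by
  rw [rightNormedMap, Representation.leftRegularMapEquiv_symm_single]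
  change (idealGen ρ (k + 1)).mkQ (permRep F (k + 1) σ (Finsupp.single (rightNormedMonomial 1) 1)) =
    _
  rw [permRep_single, relabel_rightNormedMonomial, mul_one]
  rfl

theorem rightNormedMap_toLinearMap :
    (rightNormedMap ρ k).toLinearMap = Finsupp.linearCombination F (rightNormedClass ρ) ∘ₗ
      (MonoidAlgebra.coeffLinearEquiv F).toLinearMap := by
  refine MonoidAlgebra.lhom_ext' fun σ => LinearMap.ext_ring ?_
  simpa using rightNormedMap_single ρ σ

theorem rightNormedMap_injective_iff :
    Function.Injective (rightNormedMap ρ k).toLinearMap ↔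
      LinearIndependent F (rightNormedClass ρ (k := k)) := by
  rw [rightNormedMap_toLinearMap, LinearMap.coe_comp]
  exact EquivLike.injective_comp (MonoidAlgebra.coeffLinearEquiv F) _

end Regularity

section Criterion

variable {x₁ x₂ x₃ x₄ : F}

theorem satisfiesLR_relativelyFree (n : ℕ) :
    SatisfiesLR (RelativelyFree (isOperadIdeal_idealGen (lrRelation x₁ x₂ x₃ x₄ 0 0)) n)
      x₁ x₂ x₃ x₄ :=
  lrRelation_mem_identities.1 <| le_identities_verbalQuotient _ _ _ <|
    mem_idealGen.2 fun _ _ h => h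

theorem span_range_rightNormedClass (k : ℕ) :
    Submodule.span F (Set.range (rightNormedClass (lrRelation x₁ x₂ x₃ x₄ 0 0) (k := k))) = ⊤ := by
  set ρ := lrRelation x₁ x₂ x₃ x₄ 0 0
  set V := Submodule.span F (Set.range (rightNormedClass ρ (k := k)))
  have hJ := isOperadIdeal_idealGen ρ
  have class_mem (w : Monomial (k + 1)) : (idealGen ρ (k + 1)).mkQ (Finsupp.single w 1) ∈ V := by
    rw [← multilinearClass_lift_gen hJ]
    suffices rightNormedSpan F (RelativelyFree.gen hJ) (letters w.1) ≤
        V.comap (multilinearClass hJ (k + 1)) from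
      this ((satisfiesLR_relativelyFree (k + 1)).lift_mem_rightNormedSpan w.1)
    refine rightNormedSpan_le.2 fun l z hl => ?_
    obtain ⟨σ, hσ⟩ := exists_rightNormedMonomial_eq (hl.trans w.2)
    rw [← hσ, Submodule.mem_comap, multilinearClass_lift_gen hJ]
    exact Submodule.subset_span ⟨σ, rfl⟩
  suffices V.comap (idealGen ρ (k + 1)).mkQ = ⊤ by
    rw [← Submodule.map_comap_eq_of_surjective (Submodule.mkQ_surjective _) V, this,
      Submodule.map_top, Submodule.range_mkQ]
  refine top_le_iff.1 (Finsupp.basisSingleOne.span_eq.ge.trans (Submodule.span_le.2 ?_))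
  rintro _ ⟨w, rfl⟩
  rw [Finsupp.coe_basisSingleOne]
  exact class_mem w

theorem rightNormedMap_surjective (k : ℕ) :
    Function.Surjective (rightNormedMap (lrRelation x₁ x₂ x₃ x₄ 0 0) k).toLinearMap := by
  rw [rightNormedMap_toLinearMap, LinearMap.coe_comp]
  refine (LinearMap.range_eq_top.1 ?_).comp (MonoidAlgebra.coeffLinearEquiv F).surjective
  rw [Finsupp.range_linearCombination, span_range_rightNormedClass]

/- The right-normed monomials always span, and there are as many of them in arity `n` as elements
of the symmetric group. -/
theorem isRegular_iff_linearIndependent :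
    IsRegular (lrRelation x₁ x₂ x₃ x₄ 0 0) ↔
      ∀ k, LinearIndependent F (rightNormedClass (lrRelation x₁ x₂ x₃ x₄ 0 0) (k := k)) := by
  simp only [← rightNormedMap_injective_iff]
  refine ⟨fun h k => ?_, fun h n hn => ?_⟩
  · obtain ⟨e⟩ := h (k + 1) k.succ_pos
    refine Function.Injective.of_comp (f := e.toLinearEquiv) ?_
    exact LinearMap.injective_iff_surjective
      (f := e.toLinearEquiv.toLinearMap ∘ₗ (rightNormedMap _ k).toLinearMap).2
      (e.toLinearEquiv.surjective.comp (rightNormedMap_surjective k))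
  · obtain ⟨k, rfl⟩ := Nat.exists_eq_add_of_le' hn
    exact ⟨(Representation.Equiv.mk
      (LinearEquiv.ofBijective (rightNormedMap _ k).toLinearMap
        ⟨h k, rightNormedMap_surjective k⟩) (rightNormedMap _ k).isIntertwining').symm⟩

end Criterion

section Sufficiency

variable {x₁ x₂ x₃ x₄ : F} {A V : Type*}
  [NonUnitalNonAssocRing A] [Module F A] [IsScalarTower F A A] [SMulCommClass F A A]
  [AddCommGroup V] [Module F V]

theorem SatisfiesLR.linearIndependent_rightNormedClass (h : SatisfiesLR A x₁ x₂ x₃ x₄) {k : ℕ}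
    (f : Fin (k + 1) → A) (φ : A →ₗ[F] V) {v : List (Fin (k + 1)) → V}
    (hv : LinearIndependent F v)
    (hφ : ∀ l z, φ (FreeMagma.lift f (rightNormed l z)) = v (l ++ [z])) :
    LinearIndependent F (rightNormedClass (lrRelation x₁ x₂ x₃ x₄ 0 0) (k := k)) := by
  let evalAt : FreeOperad F (k + 1) →ₗ[F] V :=
    { toFun p := φ (eval p f)
      map_add' p q := by rw [map_add, add_apply, map_add]
      map_smul' c p := by rw [map_smul, smul_apply, map_smul]; rfl }
  have evalAt_eq_zero : idealGen (lrRelation x₁ x₂ x₃ x₄ 0 0) (k + 1) ≤ LinearMap.ker evalAt :=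
    fun p hp => by
      change φ (eval p f) = 0
      rw [mem_identities.1 (h.idealGen_le_identities _ hp), map_zero]
  refine LinearIndependent.of_comp (Submodule.liftQ _ evalAt evalAt_eq_zero) ?_
  convert! hv.comp (fun σ : Equiv.Perm (Fin (k + 1)) => List.ofFn σ)
    (List.ofFn_injective.comp DFunLike.coe_injective) using 1
  ext1 σ
  change φ (eval (.single (rightNormedMonomial σ) 1) f) = v (List.ofFn σ)
  rw [eval_single, one_smul, List.ofFn_succ', List.concat_eq_append]
  exact hφ _ _

end Sufficiency

section OfBilinear

variable {R A : Type*} [CommSemiring R] [AddCommGroup A] [Module R A] {μ : A →ₗ[R] A →ₗ[R] A}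
  {x₁ x₂ x₃ x₄ : R}

theorem satisfiesLR_ofBilinear :
    SatisfiesLR (OfBilinear μ) x₁ x₂ x₃ x₄ ↔ ∀ a b c, μ (μ a b) c =
      x₁ • μ a (μ b c) + x₂ • μ a (μ c b) + x₃ • μ b (μ a c) + x₄ • μ b (μ c a) :=
  Iff.rfl

end OfBilinear

section Hemisemidirect

variable (R : Type*) [NonUnitalRing R] [Module F R] [IsScalarTower F R R] [SMulCommClass F R R]

/-- The product `(a, m)(b, n) = (α ab + β ba, an)`. With `α = 1` and `β = -1` it is the
hemisemidirect product of the commutator Lie algebra of `R` with the module `R`, which is the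
standard example of a Leibniz algebra. -/
def hemisemidirectMul (α β : F) : R × R →ₗ[F] R × R →ₗ[F] R × R :=
  LinearMap.mk₂ F (fun a b => (α • (a.1 * b.1) + β • (b.1 * a.1), a.1 * b.2))
    (fun a a' b => by
      ext <;> simp only [Prod.fst_add, Prod.snd_add, add_mul, mul_add, smul_add]
      abel)
    (fun c a b => by
      ext <;> simp only [Prod.smul_fst, Prod.smul_snd, smul_mul_assoc, mul_smul_comm, smul_add,
        smul_comm c])
    (fun a b b' => by
      ext <;> simp only [Prod.fst_add, Prod.snd_add, add_mul, mul_add, smul_add]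
      abel)
    (fun c a b => by
      ext <;> simp only [Prod.smul_fst, Prod.smul_snd, smul_mul_assoc, mul_smul_comm, smul_add,
        smul_comm c])

variable {R} {α β : F}

theorem satisfiesLR_hemisemidirectMul (hα : α * α = α) (hαβ : α * β = β) (hβ : β * β = -β) :
    SatisfiesLR (OfBilinear (hemisemidirectMul R α β)) α 0 β 0 := by
  refine satisfiesLR_ofBilinear.2 fun a b c => Prod.ext ?_ ?_ <;>
    simp only [hemisemidirectMul, LinearMap.mk₂_apply, zero_smul, add_zero, Prod.fst_add,
      Prod.snd_add, Prod.smul_fst, Prod.smul_snd, mul_add, add_mul, smul_mul_assoc, mul_smul_comm,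
      smul_add, smul_smul, mul_assoc, mul_comm β α, hα, hαβ, hβ, neg_smul, smul_neg, neg_neg]
  abel

theorem isRegular_lrRelation_hemisemidirect (hα : α * α = α) (hαβ : α * β = β) (hβ : β * β = -β) :
    IsRegular (lrRelation α 0 β 0 0 0) := by
  refine isRegular_iff_linearIndependent.2 fun k => ?_
  let μ := hemisemidirectMul (MonoidAlgebra F (FreeMonoid (Fin (k + 1)))) α β
  let letter (x : Fin (k + 1)) : MonoidAlgebra F (FreeMonoid (Fin (k + 1))) :=
    .single (.of x) 1
  let φ : OfBilinear μ →ₗ[F] MonoidAlgebra F (FreeMonoid (Fin (k + 1))) :=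
    LinearMap.snd F _ _ ∘ₗ (OfBilinear.of μ).symm.toLinearMap
  have linearIndependent_single : LinearIndependent F
      fun l : List (Fin (k + 1)) => MonoidAlgebra.single (FreeMonoid.ofList l) (1 : F) :=
    (MonoidAlgebra.basis (FreeMonoid (Fin (k + 1))) F).linearIndependent.comp _
      FreeMonoid.ofList.injective
  refine (satisfiesLR_hemisemidirectMul hα hαβ hβ).linearIndependent_rightNormedClass
    (fun x => OfBilinear.of μ (letter x, letter x)) φ linearIndependent_single fun l z => ?_
  induction l with
  | nil => rfl
  | cons a l ih =>
    refine (congrArg (letter a * ·) ih).trans ?_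
    rw [MonoidAlgebra.single_mul_single, one_mul]
    rfl

end Hemisemidirect

section Shuffle

variable {R X : Type*} [CommSemiring R]

/-- The left derivative `∂ₐ f` of a formal power series in noncommuting variables, given by its
coefficients. -/
def leftDeriv (a : X) (f : List X → R) (w : List X) : R := f (a :: w)

/-- The shuffle product `f ⧢ g` of two formal power series in noncommuting variables, determined by
its constant term and the Leibniz rule `∂ₐ (f ⧢ g) = ∂ₐ f ⧢ g + f ⧢ ∂ₐ g`. -/
def shuffle : (List X → R) → (List X → R) → List X → R
  | f, g, [] => f [] * g []
  | f, g, a :: w => shuffle (leftDeriv a f) g w + shuffle f (leftDeriv a g) w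

theorem shuffle_cons (f g : List X → R) (a : X) (w : List X) :
    shuffle f g (a :: w) = shuffle (leftDeriv a f) g w + shuffle f (leftDeriv a g) w := rfl

theorem leftDeriv_shuffle (a : X) (f g : List X → R) :
    leftDeriv a (shuffle f g) = shuffle (leftDeriv a f) g + shuffle f (leftDeriv a g) := rfl

theorem shuffle_comm (f g : List X → R) : shuffle f g = shuffle g f := by
  ext w
  induction w generalizing f g with
  | nil => exact mul_comm _ _
  | cons a w ih => rw [shuffle_cons, shuffle_cons, ih, ih f, add_comm]

theorem add_shuffle (f f' g : List X → R) : shuffle (f + f') g = shuffle f g + shuffle f' g := by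
  ext w
  induction w generalizing f f' g with
  | nil => exact add_mul _ _ _
  | cons a w ih => exact (congrArg₂ (· + ·) (ih _ _ _) (ih _ _ _)).trans (add_add_add_comm _ _ _ _)

theorem shuffle_add (f g g' : List X → R) : shuffle f (g + g') = shuffle f g + shuffle f g' := by
  simp only [shuffle_comm f, add_shuffle]

theorem smul_shuffle (c : R) (f g : List X → R) : shuffle (c • f) g = c • shuffle f g := by
  ext w
  induction w generalizing f g with
  | nil => exact mul_assoc _ _ _
  | cons a w ih => exact (congrArg₂ (· + ·) (ih _ _) (ih _ _)).trans (mul_add _ _ _).symm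

theorem shuffle_smul (c : R) (f g : List X → R) : shuffle f (c • g) = c • shuffle f g := by
  simp only [shuffle_comm f, smul_shuffle]

theorem zero_shuffle (g : List X → R) : shuffle 0 g = 0 := by
  simpa using smul_shuffle (0 : R) 0 g

theorem shuffle_assoc (f g h : List X → R) :
    shuffle (shuffle f g) h = shuffle f (shuffle g h) := by
  ext w
  induction w generalizing f g h with
  | nil => exact mul_assoc _ _ _
  | cons a w ih =>
    simp only [shuffle_cons, leftDeriv_shuffle, add_shuffle, shuffle_add, Pi.add_apply, ih,
      add_assoc]

theorem one_shuffle [DecidableEq X] (f : List X → R) : shuffle (Pi.single [] 1) f = f := by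
  ext w
  induction w generalizing f with
  | nil => exact one_mul _
  | cons a w ih =>
    have leftDeriv_one : leftDeriv a (Pi.single [] 1 : List X → R) = 0 := by
      ext v
      simp [leftDeriv]
    rw [shuffle_cons, leftDeriv_one, zero_shuffle, ih]
    exact zero_add _

/-- The formal power series with constant term zero and with the given left derivatives. -/
def ofLeftDerivs : (X → List X → R) →ₗ[R] List X → R where
  toFun f
    | [] => 0
    | a :: w => f a w
  map_add' f g := by
    ext (_ | _)
    exacts [(add_zero 0).symm, rfl]
  map_smul' c f := by
    ext (_ | _)
    exacts [(mul_zero c).symm, rfl]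

variable (R X) in
/-- The half-shuffle `f ≺ g` of two formal power series without constant term, determined by
`∂ₐ (f ≺ g) = ∂ₐ f ⧢ g`. Such a series is represented by the family of its left derivatives. -/
def halfShuffle : (X → List X → R) →ₗ[R] (X → List X → R) →ₗ[R] X → List X → R :=
  LinearMap.mk₂ R (fun f g a => shuffle (f a) (ofLeftDerivs g))
    (fun f f' g => funext fun a => add_shuffle (f a) (f' a) _)
    (fun c f g => funext fun a => smul_shuffle c (f a) _)
    (fun f g g' => funext fun a => by rw [map_add, shuffle_add]; rfl)
    (fun c f g => funext fun a => by rw [map_smul, shuffle_smul]; rfl)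

theorem halfShuffle_apply (f g : X → List X → R) (a : X) :
    halfShuffle R X f g a = shuffle (f a) (ofLeftDerivs g) := rfl

theorem ofLeftDerivs_halfShuffle_add (f g : X → List X → R) :
    ofLeftDerivs (halfShuffle R X f g + halfShuffle R X g f) =
      shuffle (ofLeftDerivs f) (ofLeftDerivs g) := by
  ext (_ | ⟨a, w⟩)
  · exact (mul_zero 0).symm
  · rw [shuffle_cons, shuffle_comm (ofLeftDerivs f)]
    rfl

theorem ofLeftDerivs_single_single [DecidableEq X] (a : X) (w : List X) (c : R) :
    ofLeftDerivs (Pi.single a (Pi.single w c)) = Pi.single (a :: w) c := by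
  ext (_ | ⟨b, v⟩)
  · rfl
  · by_cases hb : b = a
    · subst hb
      simp [ofLeftDerivs, Pi.single_apply]
    · simp [ofLeftDerivs, hb]

theorem halfShuffle_single_one [DecidableEq X] (a : X) (f : X → List X → R) :
    halfShuffle R X (Pi.single a (Pi.single [] 1)) f = Pi.single a (ofLeftDerivs f) := by
  ext1 b
  rw [halfShuffle_apply]
  by_cases hb : b = a
  · subst hb
    rw [Pi.single_eq_same, Pi.single_eq_same, one_shuffle]
  · rw [Pi.single_eq_of_ne hb, Pi.single_eq_of_ne hb, zero_shuffle]

end Shuffle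

section Zinbiel

theorem satisfiesLR_halfShuffle {X : Type*} :
    SatisfiesLR (OfBilinear (halfShuffle F X)) (1 : F) 1 0 0 :=
  satisfiesLR_ofBilinear.2 fun f g h => by
    simp only [one_smul, zero_smul, add_zero, ← map_add]
    ext1 a
    rw [halfShuffle_apply, halfShuffle_apply, halfShuffle_apply, ofLeftDerivs_halfShuffle_add,
      shuffle_assoc]

theorem isRegular_lrRelation_zinbiel : IsRegular (lrRelation (1 : F) 1 0 0 0 0) := by
  refine isRegular_iff_linearIndependent.2 fun k => ?_
  let μ := halfShuffle F (Fin (k + 1))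
  let letter (x : Fin (k + 1)) : OfBilinear μ := OfBilinear.of μ (Pi.single x (Pi.single [] 1))
  let φ : OfBilinear μ →ₗ[F] List (Fin (k + 1)) → F :=
    ofLeftDerivs ∘ₗ (OfBilinear.of μ).symm.toLinearMap
  refine satisfiesLR_halfShuffle.linearIndependent_rightNormedClass letter φ
    (Pi.linearIndependent_single_one _ F) fun l z => ?_
  induction l with
  | nil => exact ofLeftDerivs_single_single z [] 1
  | cons a l ih =>
    refine (congrArg ofLeftDerivs (halfShuffle_single_one a _)).trans ?_
    exact (congrArg (ofLeftDerivs <| Pi.single a ·) ih).trans (ofLeftDerivs_single_single a _ 1)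

end Zinbiel

section OverlapEquations

/-- Necessary conditions for regularity: the equality of the coefficients of the right-normed words
`abcd`, `acdb`, … in the two reductions of `((ab)c)d`, as a product of the three factors `ab`, `c`,
`d` and as the product of `(ab)c`, reduced first, with `d`. -/
structure OverlapEquations {R : Type*} [CommRing R] (x₁ x₂ x₃ x₄ : R) : Prop where
  abcd : x₁ ^ 2 = (x₂ * x₃ + x₄ ^ 2) ^ 2 + x₁ * x₂ * x₃ + x₁ ^ 3
  acdb : x₁ ^ 2 * x₂ + x₂ ^ 2 * x₃ = x₁ ^ 2 * x₄ + x₁ * x₂ ^ 2 + x₁ * x₃ * x₄ + x₃ * x₄ ^ 2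
  adcb : x₁ * x₂ * (x₂ + x₃) = x₂ ^ 2 + x₄ * (x₂ + x₃) * (x₂ * x₃ + x₄ ^ 2)
  bcad : x₂ * x₄ * (x₁ + x₄) = x₁ ^ 2 * (x₃ + x₄) + (x₁ + x₂) * x₃ ^ 2
  bcda : 0 = x₁ * x₄ * (x₂ + x₃)
  cbad : x₃ ^ 2 = x₁ * x₃ * (x₂ + x₃) + x₄ * (x₂ + x₃) * (x₂ * x₃ + x₄ ^ 2)
  cdab : x₄ = (x₂ * x₃) ^ 2 + (x₂ + x₃) ^ 2 * x₄ ^ 2 + x₁ * x₄ * (x₂ ^ 2 + x₃ ^ 2 + x₁ * x₄)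

namespace OverlapEquations

variable {R : Type*} [CommRing R] [IsDomain R] {x₁ x₂ x₃ x₄ : R}

theorem fourth_eq_zero (h : OverlapEquations x₁ x₂ x₃ x₄) : x₄ = 0 := by
  rcases mul_eq_zero.1 h.bcda.symm with h₁₄ | h₂₃
  · refine (mul_eq_zero.1 h₁₄).elim (fun h₁ => ?_) id
    have h₂₃₄ : x₂ * x₃ + x₄ ^ 2 = 0 :=
      sq_eq_zero_iff.1 (by linear_combination (x₁ - x₁ ^ 2 - x₂ * x₃) * h₁ - h.abcd)
    have h₂ : x₂ = 0 := sq_eq_zero_iff.1 <| by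
      linear_combination x₂ * (x₂ + x₃) * h₁ - h.adcb - x₄ * (x₂ + x₃) * h₂₃₄
    exact sq_eq_zero_iff.1 (by linear_combination h₂₃₄ - x₃ * h₂)
  · have h₂ : x₂ = 0 := sq_eq_zero_iff.1 <| by
      linear_combination (x₁ * x₂ - x₄ * (x₂ * x₃ + x₄ ^ 2)) * h₂₃ - h.adcb
    have h₃ : x₃ = 0 := by simpa [h₂] using h₂₃
    obtain h₁ | h₄ : x₁ = 0 ∨ x₄ = 0 := by simpa [h₂, h₃] using h.bcad
    · simpa [h₁, h₂, h₃] using h.abcd.symm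
    · exact h₄

theorem eq_or_eq_or_eq_or_eq (h : OverlapEquations x₁ x₂ x₃ x₄) :
    (x₁, x₂, x₃, x₄) = (0, 0, 0, 0) ∨ (x₁, x₂, x₃, x₄) = (1, 0, 0, 0) ∨
      (x₁, x₂, x₃, x₄) = (1, 1, 0, 0) ∨ (x₁, x₂, x₃, x₄) = (1, 0, -1, 0) := by
  obtain rfl := h.fourth_eq_zero
  have h₂₃ : x₂ = 0 ∨ x₃ = 0 := by simpa using h.cdab.symm
  have h₁ : x₁ = 0 ∨ x₁ = 1 := by
    have h₂₃' : x₂ * x₃ = 0 := mul_eq_zero.2 h₂₃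
    have : x₁ ^ 2 * (x₁ - 1) = 0 := by
      linear_combination -h.abcd - (x₂ * x₃ + x₁) * h₂₃'
    simpa [sub_eq_zero] using this
  rcases h₁ with rfl | rfl
  · have h₂ : x₂ = 0 := by simpa using h.adcb.symm
    have h₃ : x₃ = 0 := by simpa using h.cbad
    simp [h₂, h₃]
  · rcases h₂₃ with rfl | rfl
    · have : x₃ * (x₃ + 1) = 0 := by linear_combination -h.bcad
      rcases mul_eq_zero.1 this with h₃ | h₃
      · simp [h₃]
      · simp [eq_neg_of_add_eq_zero_left h₃]
    · have : x₂ * (x₂ - 1) = 0 := by linear_combination -h.acdb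
      rcases mul_eq_zero.1 this with h₂ | h₂
      · simp [h₂]
      · simp [sub_eq_zero.1 h₂]

end OverlapEquations

end OverlapEquations

section Necessity

variable {x₁ x₂ x₃ x₄ : F}

theorem exists_coeffs_of_linearIndependent {V : Type*} [AddCommGroup V] [Module F V]
    {n : ℕ} {m : (Fin n → Fin n) → V}
    (hm : LinearIndependent F fun σ : Equiv.Perm (Fin n) => m σ) :
    ∃ coeffs : V →ₗ[F] (Fin n → Fin n) →₀ F,
      ∀ w, Function.Injective w → coeffs (m w) = Finsupp.single w 1 := by
  obtain ⟨coords, hcoords⟩ :=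
    LinearMap.exists_leftInverse_of_injective _ (LinearMap.ker_eq_bot.2 hm)
  refine ⟨Finsupp.lmapDomain F F (fun σ : Equiv.Perm (Fin n) => (σ : Fin n → Fin n)) ∘ₗ coords,
    fun w hw => ?_⟩
  let σ := Equiv.ofBijective w (Finite.injective_iff_bijective.1 hw)
  have coords_word : coords (m w) = Finsupp.single σ 1 := by
    simpa [σ] using LinearMap.congr_fun hcoords (Finsupp.single σ 1)
  rw [LinearMap.comp_apply, coords_word]
  exact Finsupp.mapDomain_single

theorem SatisfiesLR.overlapEquations {A : Type*} [NonUnitalNonAssocRing A] [Module F A]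
    [IsScalarTower F A A] [SMulCommClass F A A] (h : SatisfiesLR A x₁ x₂ x₃ x₄) (g : Fin 4 → A)
    (hg : LinearIndependent F fun σ : Equiv.Perm (Fin 4) =>
      g (σ 0) * (g (σ 1) * (g (σ 2) * g (σ 3)))) :
    OverlapEquations x₁ x₂ x₃ x₄ := by
  obtain ⟨coeffs, hcoeffs⟩ := exists_coeffs_of_linearIndependent
    (m := fun w => g (w 0) * (g (w 1) * (g (w 2) * g (w 3)))) hg
  have coeffs_word (i j k l : Fin 4) (hinj : Function.Injective ![i, j, k, l]) :
      coeffs (g i * (g j * (g k * g l))) = Finsupp.single ![i, j, k, l] 1 := hcoeffs _ hinj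
  have two_reductions :
      x₁ • (g 0 * g 1 * (g 2 * g 3)) + x₂ • (g 0 * g 1 * (g 3 * g 2)) +
        x₃ • (g 2 * (g 0 * g 1 * g 3)) + x₄ • (g 2 * (g 3 * (g 0 * g 1))) =
      (x₁ • (g 0 * (g 1 * g 2)) + x₂ • (g 0 * (g 2 * g 1)) +
        x₃ • (g 1 * (g 0 * g 2)) + x₄ • (g 1 * (g 2 * g 0))) * g 3 := by
    rw [← h, ← h]
  replace two_reductions := congrArg coeffs two_reductions
  simp only [h _ _ _, mul_add, add_mul, smul_mul_assoc, mul_smul_comm, map_add, map_smul]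
    at two_reductions
  simp (disch := decide) only [coeffs_word] at two_reductions
  have coeff_eq (w : Fin 4 → Fin 4) := DFunLike.congr_fun two_reductions w
  simp only [Finsupp.add_apply, Finsupp.smul_apply, Finsupp.single_apply, smul_eq_mul,
    mul_ite, mul_one, mul_zero] at coeff_eq
  constructor
  case' abcd => have := coeff_eq ![0, 1, 2, 3]
  case' acdb => have := coeff_eq ![0, 2, 3, 1]
  case' adcb => have := coeff_eq ![0, 3, 2, 1]
  case' bcad => have := coeff_eq ![1, 2, 0, 3]
  case' bcda => have := coeff_eq ![1, 2, 3, 0]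
  case' cbad => have := coeff_eq ![2, 1, 0, 3]
  case' cdab => have := coeff_eq ![2, 3, 0, 1]
  all_goals
    simp +decide only [if_true, if_false, mul_zero, add_zero, zero_add] at this
    linear_combination this

theorem IsRegular.overlapEquations (h : IsRegular (lrRelation x₁ x₂ x₃ x₄ 0 0)) :
    OverlapEquations x₁ x₂ x₃ x₄ := by
  have hJ := isOperadIdeal_idealGen (lrRelation x₁ x₂ x₃ x₄ 0 0)
  refine (satisfiesLR_relativelyFree 4).overlapEquations (RelativelyFree.gen hJ)
    (.of_comp (multilinearClass hJ 4) ?_)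
  convert isRegular_iff_linearIndependent.1 h 3 using 1
  funext σ
  exact multilinearClass_lift_gen hJ (rightNormedMonomial σ)

end Necessity

end LROperad

end

theorem mainTheorem4_general (F : Type*) [Field F] :
    (∀ x₁ x₂ x₃ x₄ x₅ x₆ : F, x₅ = 0 → x₆ = 0 →
      (LROperad.IsRegular (LROperad.lrRelation x₁ x₂ x₃ x₄ x₅ x₆) ↔
        (x₁, x₂, x₃, x₄) = (0, 0, 0, 0) ∨ (x₁, x₂, x₃, x₄) = (1, 0, 0, 0) ∨
          (x₁, x₂, x₃, x₄) = (1, 1, 0, 0) ∨ (x₁, x₂, x₃, x₄) = (1, 0, -1, 0))) ∧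
    LROperad.lrRelation 0 0 0 0 0 0 = LROperad.leftNilpotentRelation F ∧
    LROperad.lrRelation 1 0 0 0 0 0 = LROperad.associativeRelation F ∧
    LROperad.lrRelation 1 1 0 0 0 0 = LROperad.zinbielRelation F ∧
    LROperad.lrRelation 1 0 (-1) 0 0 0 = LROperad.leibnizRelation F := by
  refine ⟨?_, ?_, ?_, ?_, ?_⟩
  · rintro x₁ x₂ x₃ x₄ _ _ rfl rfl
    refine ⟨fun h => h.overlapEquations.eq_or_eq_or_eq_or_eq, ?_⟩
    rintro (h | h | h | h) <;> obtain ⟨rfl, rfl, rfl, rfl⟩ := by simpa only [Prod.mk.injEq] using h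
    · exact LROperad.isRegular_lrRelation_hemisemidirect (by simp) (by simp) (by simp)
    · exact LROperad.isRegular_lrRelation_hemisemidirect (by simp) (by simp) (by simp)
    · exact LROperad.isRegular_lrRelation_zinbiel
    · exact LROperad.isRegular_lrRelation_hemisemidirect (by simp) (by simp) (by simp)
  · simp [LROperad.lrRelation, LROperad.leftNilpotentRelation]
  · simp [LROperad.lrRelation, LROperad.associativeRelation]
  · simp [LROperad.lrRelation, LROperad.zinbielRelation]
  · simp [LROperad.lrRelation, LROperad.leibnizRelation, sub_eq_add_neg]

theorem mainTheorem4 (F : Type*) [Field F] [CharZero F] :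
    (∀ x₁ x₂ x₃ x₄ x₅ x₆ : F, x₅ = 0 → x₆ = 0 →
      (LROperad.IsRegular (LROperad.lrRelation x₁ x₂ x₃ x₄ x₅ x₆) ↔
        (x₁, x₂, x₃, x₄) = (0, 0, 0, 0) ∨ (x₁, x₂, x₃, x₄) = (1, 0, 0, 0) ∨
          (x₁, x₂, x₃, x₄) = (1, 1, 0, 0) ∨ (x₁, x₂, x₃, x₄) = (1, 0, -1, 0))) ∧
    LROperad.lrRelation 0 0 0 0 0 0 = LROperad.leftNilpotentRelation F ∧
    LROperad.lrRelation 1 0 0 0 0 0 = LROperad.associativeRelation F ∧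
    LROperad.lrRelation 1 1 0 0 0 0 = LROperad.zinbielRelation F ∧
    LROperad.lrRelation 1 0 (-1) 0 0 0 = LROperad.leibnizRelation F :=
  mainTheorem4_general F
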